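/- For positive integers $m,k$, call a finite sequence $s_0s_1\cdots s_{M-1}$ of length $M\ge m$ with entries in $[k]=\{1,\dots,k\}$ *$m$-distinguishable* if the multisets $\{s_t,s_{t+1},\dots,s_{t+m-1}\}$, $0\le t\le M-m$, are pairwise distinct, and let $M_m(k)$ denote the maximum length of an $m$-distinguishable sequence with entries in $[k]$. Then: 1. $M_1(k)=k$ for all integers $k\ge 1$; 2. $M_2(k)=\binom{k+1}{2}+1$ for all odd integers $k\ge 1$; 3. with $y_0(3)=4$, $y_0(4)=5$ and $y_0(6)=11$: for every $m\in\{3,4,6\}$ and every integer $k\ge y_0(m)$ with $\gcd(m,k)=1$, $$M_m(k)=\binom{k+m-1}{m}+m-1 .$$ -/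

import Mathlib

/-- The colour multiset `S_m(t) = {s_t, s_{t+1}, …, s_{t+m-1}}` tagged at position `t` of the
sequence `s` (positions are numbered from `0`; used only for `t + m ≤ s.length`). -/
def colorMultiset {α : Type*} (m : ℕ) (s : List α) (t : ℕ) : Multiset α :=
  ↑((s.drop t).take m)

/-- A sequence of length `M ≥ m` is `m`-distinguishable if the multisets `S_m(t)`,
`0 ≤ t ≤ M - m`, are all distinct. -/
def IsDistinguishable {α : Type*} (m : ℕ) (s : List α) : Prop :=
  m ≤ s.length ∧ ∀ t t' : ℕ, t + m ≤ s.length → t' + m ≤ s.length →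
    colorMultiset m s t = colorMultiset m s t' → t = t'

/-- The set of all lengths of `m`-distinguishable sequences over a set of `k` colours. -/
def distinguishableLengths (m k : ℕ) : Set ℕ :=
  {M | ∃ s : List (Fin k), IsDistinguishable m s ∧ s.length = M}

/-- `M_m(k)`: the maximum length of an `m`-distinguishable sequence over a set of `k` colours.
The maximum exists for `k ≥ 1`, see `isGreatest_maxDistinguishableLength`. -/
noncomputable def maxDistinguishableLength (m k : ℕ) : ℕ :=
  sSup (distinguishableLengths m k)

/-- For positive `k` the supremum defining `M_m(k)` is an attained maximum. -/
theorem isGreatest_maxDistinguishableLength (m k : ℕ) (hk : 1 ≤ k) :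
    IsGreatest (distinguishableLengths m k) (maxDistinguishableLength m k) := by
  have hne : (distinguishableLengths m k).Nonempty := by
    refine ⟨m, List.replicate m ⟨0, hk⟩, ⟨by simp, ?_⟩, by simp⟩
    intro t t' h h' _
    simp only [List.length_replicate] at h h'
    omega
  have hbdd : BddAbove (distinguishableLengths m k) := by
    refine ⟨Fintype.card (Sym (Fin k) m) + m, ?_⟩
    rintro M ⟨s, ⟨hm, hs⟩, rfl⟩
    let f : Fin (s.length - m + 1) → Sym (Fin k) m := fun t =>
      ⟨colorMultiset m s t, by
        have := t.2
        simp only [colorMultiset, Multiset.coe_card, List.length_take, List.length_drop]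
        omega⟩
    have hinj : Function.Injective f := by
      intro t t' h
      have h1 := t.2
      have h2 := t'.2
      exact Fin.ext (hs t t' (by omega) (by omega) (congrArg Subtype.val h))
    have := Fintype.card_le_of_injective _ hinj
    rw [Fintype.card_fin] at this
    omega
  exact ⟨Nat.sSup_mem hne hbdd, fun _ h => le_csSup hbdd h⟩

/-! Counting multisets of size $m$ gives the upper bound, so an optimal sequence must have every
multiset as a window exactly once.

Take $\mathbb{Z}/k$ as alphabet and write $m=r+2$. The cyclic gaps of a multiset sum to $k$. A rule
`sel`, which depends only on the multiset of gaps, picks a gap that occurs exactly once. Cutting the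
circle there puts the points in linear order, so multisets correspond to pairs of a first point and
$r+1$ differences (`StartDiff.card_eq_and_points_injective`). Regard such a pair as an edge from its
first $m-1$ points to its last $m-1$ points. Rotating the differences keeps the multiset of gaps, so
`StartDiff.rot` permutes the edges and the graph is balanced. If it is also connected, it has an
Eulerian circuit, whose windows are all the multisets (`maxDistinguishableLength_eq_of_rule`).

For $m\in\{2,3,4,6\}$ and $\gcd(m,k)=1$ some gap is simple: if all multiplicities were at least 2,
the sum would share a factor with $m$. The rule takes the largest simple gap, altered at one
multiset for $m=3,6$ to secure connectedness. The case $m=1$ and two small cases use explicit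
sequences. -/

/-! ### Eulerian circuits by merging cycles -/

/-- If `a` and `b` lie in different cycles of `τ`, then the cycle of `a` under `swap a b * τ` contains
the cycle of `a` under `τ`. -/
theorem sameCycle_swap_mul {E : Type*} [Finite E] [DecidableEq E] {τ : Equiv.Perm E} {a b z : E}
    (hab : ¬ τ.SameCycle a b) (hz : τ.SameCycle a z) :
    (Equiv.swap a b * τ).SameCycle a z := by
  obtain ⟨n, rfl⟩ := hz.exists_nat_pow_eq
  clear hz
  induction n with
  | zero => exact Equiv.Perm.SameCycle.refl _ _
  | succ n ih =>
    have hsc : τ.SameCycle a ((τ ^ (n + 1)) a) := ⟨(n + 1 : ℕ), by rw [zpow_natCast]⟩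
    by_cases h1 : (τ ^ (n + 1)) a = a
    · rw [h1]
    · have h2 : (τ ^ (n + 1)) a ≠ b := fun h => hab (h ▸ hsc)
      have : (Equiv.swap a b * τ) ((τ ^ n) a) = (τ ^ (n + 1)) a := by
        rw [Equiv.Perm.mul_apply, ← Equiv.Perm.mul_apply τ, ← pow_succ',
          Equiv.swap_apply_of_ne_of_ne h1 h2]
      rw [← this]
      exact Equiv.Perm.sameCycle_apply_right.2 ih

/-- Two cycles of a permutation of a finite type that meet the same fibre of `src` can be merged, so
a connected balanced directed multigraph has an Eulerian circuit. -/
theorem exists_perm_sameCycle_of_eqvGen {E V : Type*} [Finite E] (src : E → V)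
    (σ : Equiv.Perm E)
    (hconn : ∀ e f, Relation.EqvGen (fun e f => src e = src f ∨ f = σ e) e f) :
    ∃ τ : Equiv.Perm E, (∀ e, src (τ e) = src (σ e)) ∧ ∀ e f, τ.SameCycle e f := by
  classical
  rcases isEmpty_or_nonempty E with hE | ⟨⟨e₀⟩⟩
  · exact ⟨σ, fun _ => rfl, fun e => hE.elim e⟩
  let good : Set (Equiv.Perm E) := {τ | ∀ e, src (τ e) = src (σ e)}
  -- Maximality of the cycle through `e₀` forces it to absorb every fibre of `src` that it meets.
  obtain ⟨τ, hτ, hmax⟩ := Set.exists_max_image good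
    (fun τ => Set.ncard {f | τ.SameCycle e₀ f}) (Set.toFinite _) ⟨σ, fun _ => rfl⟩
  refine ⟨τ, hτ, ?_⟩
  suffices h : ∀ f, τ.SameCycle e₀ f from fun e f => (h e).symm.trans (h f)
  have hsrc : ∀ e f, src e = src f → τ.SameCycle e₀ e → τ.SameCycle e₀ f := by
    intro e f hef he
    by_contra hf
    let τ' := Equiv.swap e f * τ
    have hgood : τ' ∈ good := by
      intro z
      rw [← hτ z]
      simp only [τ', Equiv.Perm.mul_apply, Equiv.swap_apply_def]
      split_ifs with h1 h2
      · rw [h1, hef]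
      · rw [h2, hef]
      · rfl
    have he' : ∀ z, τ.SameCycle e z → τ'.SameCycle e z := fun z hz =>
      sameCycle_swap_mul (fun h => hf (he.trans h)) hz
    have hf' : ∀ z, τ.SameCycle f z → τ'.SameCycle f z := fun z hz => by
      simp only [τ', Equiv.swap_comm e f]
      exact sameCycle_swap_mul (fun h => hf (he.trans h.symm)) hz
    have hfe : τ'.SameCycle f e := by
      have h1 := hf' (τ.symm f) ⟨-1, by simp⟩
      have h2 : τ' (τ.symm f) = e := by simp [τ']
      rw [← h2]
      exact Equiv.Perm.sameCycle_apply_right.2 h1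
    have hsub : {z | τ.SameCycle e₀ z} ⊂ {z | τ'.SameCycle e₀ z} := by
      have h0 : τ'.SameCycle e₀ e := (he' _ he.symm).symm
      refine ⟨fun z hz => h0.trans (he' _ (he.symm.trans hz)), fun h => hf (h ?_)⟩
      exact h0.trans hfe.symm
    exact absurd (hmax τ' hgood) (not_le.2 (Set.ncard_lt_ncard hsub (Set.toFinite _)))
  have hiff : ∀ e f, Relation.EqvGen (fun e f => src e = src f ∨ f = σ e) e f →
      (τ.SameCycle e₀ e ↔ τ.SameCycle e₀ f) := by
    intro e f h
    induction h with
    | rel e f h =>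
      rcases h with h | rfl
      · exact ⟨hsrc e f h, hsrc f e h.symm⟩
      · rw [← Equiv.Perm.sameCycle_apply_right (f := τ) (y := e)]
        exact ⟨hsrc _ _ (hτ e), hsrc _ _ (hτ e).symm⟩
    | refl => exact Iff.rfl
    | symm _ _ _ ih => exact ih.symm
    | trans _ _ _ _ _ ih1 ih2 => exact ih1.trans ih2
  exact fun f => (hiff e₀ f (hconn e₀ f)).1 (Equiv.Perm.SameCycle.refl _ _)

/-! ### The counting bound and sequences from circuits -/

/-- There are not enough multisets for longer distinguishable sequences. -/
theorem IsDistinguishable.length_add_one_le {α : Type*} [Fintype α] {m : ℕ} {s : List α}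
    (h : IsDistinguishable m s) :
    s.length + 1 ≤ (Fintype.card α + m - 1).choose m + m := by
  classical
  obtain ⟨hm, hs⟩ := h
  let f : Fin (s.length - m + 1) → Sym α m := fun t =>
    ⟨colorMultiset m s t, by
      have := t.2
      simp only [colorMultiset, Multiset.coe_card, List.length_take, List.length_drop]
      omega⟩
  have hinj : Function.Injective f := by
    intro t t' h
    have h1 := t.2
    have h2 := t'.2
    exact Fin.ext (hs t t' (by omega) (by omega) (congrArg Subtype.val h))
  have := Fintype.card_le_of_injective _ hinj
  rw [Fintype.card_fin, Sym.card_sym_eq_choose] at this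
  omega

/-- An optimal sequence over any alphabet with `k` letters determines `M_m(k)`. -/
theorem maxDistinguishableLength_eq_of_isDistinguishable {α : Type*} [Fintype α] {m k : ℕ}
    (hk : 1 ≤ k) (hα : Fintype.card α = k) {s : List α} (h : IsDistinguishable m s)
    (hs : s.length + 1 = (k + m - 1).choose m + m) :
    maxDistinguishableLength m k = (k + m - 1).choose m + m - 1 := by
  have hg := isGreatest_maxDistinguishableLength m k hk
  let e : α ≃ Fin k := Fintype.equivFinOfCardEq hα
  have hmem : s.length ∈ distinguishableLengths m k := by
    refine ⟨s.map e, ⟨by simpa using h.1, fun t t' ht ht' htt => ?_⟩, by simp⟩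
    rw [List.length_map] at ht ht'
    refine h.2 t t' ht ht' (Multiset.map_injective e.injective ?_)
    simpa [colorMultiset, ← List.map_drop, ← List.map_take] using htt
  have h1 := hg.2 hmem
  obtain ⟨s', hs', hl⟩ := hg.1
  have h2 := hs'.length_add_one_le
  rw [Fintype.card_fin] at h2
  omega

/-- A cyclic permutation `τ` of a set `E` of edges, with heads `hd`, yields a sequence. -/
theorem exists_isDistinguishable_of_sameCycle {α E : Type*} [Fintype E] [Nonempty E]
    (m : ℕ) (hm : 1 ≤ m) (hd : E → α) (τ : Equiv.Perm E) (hτ : ∀ e f, τ.SameCycle e f)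
    (hinj : Function.Injective
      fun e => (Multiset.range m).map fun j => hd ((τ ^ j) e)) :
    ∃ s : List α, IsDistinguishable m s ∧ s.length + 1 = Fintype.card E + m := by
  classical
  obtain ⟨e₀⟩ := ‹Nonempty E›
  have hcyc : τ.IsCycleOn ((Finset.univ : Finset E) : Set E) :=
    ⟨by simp, fun e _ f _ => hτ e f⟩
  have hpos : 0 < Fintype.card E := Fintype.card_pos_iff.2 ⟨e₀⟩
  let s : List α := (List.range (Fintype.card E + m - 1)).map fun t => hd ((τ ^ t) e₀)
  have hlen : s.length = Fintype.card E + m - 1 := by simp [s]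
  have hwin : ∀ t, t + m ≤ s.length → colorMultiset m s t =
      (Multiset.range m).map fun j => hd ((τ ^ j) ((τ ^ t) e₀)) := by
    intro t ht
    rw [← Multiset.coe_range, Multiset.map_coe]
    unfold colorMultiset
    congr 1
    apply List.ext_getElem
    · simp; omega
    · intro i h1 h2
      simp [s, ← Equiv.Perm.mul_apply, ← pow_add, add_comm]
  refine ⟨s, ⟨by omega, fun t t' ht ht' htt => ?_⟩, by omega⟩
  rw [hwin t ht, hwin t' ht'] at htt
  have h := hinj htt
  rw [hcyc.pow_apply_eq_pow_apply (Finset.mem_univ _), Finset.card_univ] at h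
  exact Nat.ModEq.eq_of_lt_of_lt h (by omega) (by omega)

/-! ### Multisets in `ZMod k` cut open at a selected gap -/

section CyclicDifferences

open scoped Fin.NatCast Fin.CommRing

/-- The parts of the cyclic composition of `k` whose parts are the entries of `D` and one further
part, which is appended. -/
def cyclicParts {r : ℕ} (k : ℕ) (D : Fin (r + 1) → ℕ) : Multiset ℕ :=
  (k - ∑ i, D i) ::ₘ Finset.univ.val.map D

/-- The tuples of differences for which the rule `sel` selects the appended part. -/
def selectedTuples (sel : Multiset ℕ → ℕ) (k r : ℕ) : Finset (Fin (r + 1) → ℕ) :=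
  {D ∈ Fintype.piFinset fun _ => Finset.range (k + 1) |
    ∑ i, D i ≤ k ∧ sel (cyclicParts k D) = k - ∑ i, D i}

theorem mem_selectedTuples {sel : Multiset ℕ → ℕ} {k r : ℕ} {D : Fin (r + 1) → ℕ} :
    D ∈ selectedTuples sel k r ↔ ∑ i, D i ≤ k ∧ sel (cyclicParts k D) = k - ∑ i, D i := by
  simp only [selectedTuples, Finset.mem_filter, Fintype.mem_piFinset, Finset.mem_range,
    and_iff_right_iff_imp]
  rintro ⟨h, -⟩ i
  have := Finset.single_le_sum (f := D) (fun _ _ => Nat.zero_le _) (Finset.mem_univ i)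
  omega

theorem sum_shift {r : ℕ} (D : Fin (r + 1) → ℕ) (a : Fin (r + 1)) :
    ∑ i, D (i + a) = ∑ i, D i :=
  Equiv.sum_comp (Equiv.addRight a) D

theorem cyclicParts_shift {r : ℕ} (k : ℕ) (D : Fin (r + 1) → ℕ) (a : Fin (r + 1)) :
    cyclicParts k (fun i => D (i + a)) = cyclicParts k D := by
  unfold cyclicParts
  rw [sum_shift]
  congr 1
  conv_rhs => rw [← Multiset.map_univ_val_equiv (Equiv.addRight a), Multiset.map_map]
  rfl

theorem shift_mem_selectedTuples {sel : Multiset ℕ → ℕ} {k r : ℕ} {D : Fin (r + 1) → ℕ}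
    (h : D ∈ selectedTuples sel k r) (a : Fin (r + 1)) :
    (fun i => D (i + a)) ∈ selectedTuples sel k r := by
  rw [mem_selectedTuples] at h ⊢
  rwa [cyclicParts_shift, sum_shift]

/-- A starting point together with a selected tuple of differences. -/
abbrev StartDiff (sel : Multiset ℕ → ℕ) (k r : ℕ) : Type :=
  ZMod k × {D // D ∈ selectedTuples sel k r}

/-- Move the starting point along the first difference and rotate the differences. -/
def StartDiff.rot (sel : Multiset ℕ → ℕ) (k r : ℕ) : Equiv.Perm (StartDiff sel k r) where
  toFun e := (e.1 + (e.2.1 0 : ZMod k), ⟨fun i => e.2.1 (i + 1), shift_mem_selectedTuples e.2.2 1⟩)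
  invFun e := (e.1 - (e.2.1 (-1) : ZMod k),
    ⟨fun i => e.2.1 (i + -1), shift_mem_selectedTuples e.2.2 (-1)⟩)
  left_inv e := by ext <;> simp
  right_inv e := by ext <;> simp

/-- The data which determine all points but the last. -/
def StartDiff.src {sel : Multiset ℕ → ℕ} {k r : ℕ} (e : StartDiff sel k r) :
    ZMod k × (Fin r → ℕ) :=
  (e.1, fun i => e.2.1 i.castSucc)

theorem StartDiff.rot_pow_snd {sel : Multiset ℕ → ℕ} {k r : ℕ} (e : StartDiff sel k r) (j : ℕ) :
    ((StartDiff.rot sel k r ^ j) e).2.1 = fun i => e.2.1 (i + (j : Fin (r + 1))) := by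
  induction j with
  | zero => simp
  | succ j ih =>
    rw [pow_succ', Equiv.Perm.mul_apply]
    simp only [StartDiff.rot, Equiv.coe_fn_mk] at ih ⊢
    rw [ih]
    funext i
    push_cast
    rw [add_assoc, add_comm 1]

theorem StartDiff.rot_pow_fst {sel : Multiset ℕ → ℕ} {k r : ℕ} (e : StartDiff sel k r) (j : ℕ) :
    ((StartDiff.rot sel k r ^ j) e).1 =
      e.1 + ∑ i ∈ Finset.range j, (e.2.1 (i : Fin (r + 1)) : ZMod k) := by
  induction j with
  | zero => simp
  | succ j ih =>
    have h := congrFun (StartDiff.rot_pow_snd e j) 0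
    rw [pow_succ', Equiv.Perm.mul_apply, Finset.sum_range_succ, ← add_assoc, ← ih]
    simp only [StartDiff.rot, Equiv.coe_fn_mk] at h ⊢
    rw [h, zero_add]

theorem StartDiff.rot_pow_fst_congr {sel : Multiset ℕ → ℕ} {k r : ℕ} {e f : StartDiff sel k r}
    (h : StartDiff.src e = StartDiff.src f) {j : ℕ} (hj : j ≤ r) :
    ((StartDiff.rot sel k r ^ j) e).1 = ((StartDiff.rot sel k r ^ j) f).1 := by
  rw [StartDiff.rot_pow_fst, StartDiff.rot_pow_fst]
  simp only [StartDiff.src, Prod.mk.injEq] at h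
  congr 1
  · exact h.1
  · refine Finset.sum_congr rfl fun i hi => ?_
    have hi : i < r := (Finset.mem_range.1 hi).trans_le hj
    have := congrFun h.2 ⟨i, hi⟩
    have hc : (i : Fin (r + 1)) = Fin.castSucc ⟨i, hi⟩ := by
      ext; simp [Fin.val_natCast, Nat.mod_eq_of_lt (by omega : i < r + 1)]
    rw [hc]
    exact congrArg _ this

/-- A step of `τ` may alter only the last difference of the rotated edge, and that difference does
not affect the start during the next `r` steps. Hence windows along the Eulerian circuit are still
the point multisets of edges. -/
theorem StartDiff.pow_fst_eq_rot_pow_fst {sel : Multiset ℕ → ℕ} {k r : ℕ}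
    {τ : Equiv.Perm (StartDiff sel k r)}
    (hτ : ∀ e, StartDiff.src (τ e) = StartDiff.src (StartDiff.rot sel k r e))
    {j : ℕ} (hj : j ≤ r + 1) (e : StartDiff sel k r) :
    ((τ ^ j) e).1 = ((StartDiff.rot sel k r ^ j) e).1 := by
  induction j generalizing e with
  | zero => rfl
  | succ j ih =>
    rw [pow_succ, pow_succ, Equiv.Perm.mul_apply, Equiv.Perm.mul_apply, ih (by omega)]
    exact StartDiff.rot_pow_fst_congr (hτ e) (by omega)

theorem StartDiff.rot_pow_card {sel : Multiset ℕ → ℕ} {k r : ℕ} (e : StartDiff sel k r) :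
    (StartDiff.rot sel k r ^ (r + 1)) e = (e.1 + ((∑ i, e.2.1 i : ℕ) : ZMod k), e.2) := by
  refine Prod.ext ?_ (Subtype.ext ?_)
  · rw [StartDiff.rot_pow_fst, Finset.sum_range]
    simp
  · rw [StartDiff.rot_pow_snd]
    simp

/-- The points visited, as a multiset. -/
def StartDiff.points {sel : Multiset ℕ → ℕ} {k r : ℕ} (e : StartDiff sel k r) :
    Multiset (ZMod k) :=
  (Multiset.range (r + 2)).map fun j => ((StartDiff.rot sel k r ^ j) e).1

/-- The points of a multiset in `ℤ/k`, in cyclic order, with the differences between them. -/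
theorem exists_cyclic_order {k n : ℕ} [NeZero k] (T : Multiset (ZMod k)) (hT : T.card = n + 1) :
    ∃ (y : Fin (n + 1) → ZMod k) (c : Fin (n + 1) → ℕ), T = Finset.univ.val.map y ∧
      ∑ i, c i = k ∧ ∀ i, y (i + 1) = y i + (c i : ZMod k) := by
  obtain ⟨f, hf⟩ : ∃ f : Fin (n + 1) → ZMod k, T = Finset.univ.val.map f := by
    obtain ⟨l, rfl⟩ := Quot.exists_rep T
    simp only [Multiset.quot_mk_to_coe'', Multiset.coe_card] at hT ⊢
    refine ⟨fun i => l.get (i.cast hT.symm), ?_⟩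
    rw [Fin.univ_val_map]
    congr 1
    apply List.ext_getElem
    · simp only [List.length_ofFn, hT]
    · intro i h1 h2
      rw [List.getElem_ofFn]
      rfl
  let g : Fin (n + 1) → ℕ := fun i => (f i).val
  let p := Tuple.sort g
  have hmono : Monotone (g ∘ p) := Tuple.monotone_sort g
  have hlt : ∀ i, g i < k := fun i => ZMod.val_lt _
  have hcast : ∀ i, ((g i : ℕ) : ZMod k) = f i := fun i => by simp [g]
  have hle : ∀ i : Fin n, g (p i.castSucc) ≤ g (p i.succ) := fun i =>
    hmono i.castSucc_le_succ
  -- Gaps of the sorted representatives in $[0,k)$; the last one wraps around, which makes the sum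
  -- exactly `k`.
  refine ⟨f ∘ p, Fin.snoc (α := fun _ => ℕ) (fun i => g (p i.succ) - g (p i.castSucc))
    (k + g (p 0) - g (p (Fin.last n))), ?_, ?_, ?_⟩
  · rw [hf, ← Multiset.map_map, Multiset.map_univ_val_equiv]
  · rw [Fin.sum_univ_castSucc]
    simp only [Fin.snoc_castSucc, Fin.snoc_last]
    have h1 : ∑ i : Fin n, (g (p i.succ) - g (p i.castSucc)) + g (p 0) = g (p (Fin.last n)) := by
      zify
      rw [Finset.sum_congr rfl fun i _ => Nat.cast_sub (hle i)]
      have := Fin.sum_univ_succ fun i => (g (p i) : ℤ)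
      have := Fin.sum_univ_castSucc fun i => (g (p i) : ℤ)
      rw [Finset.sum_sub_distrib]
      linarith
    have := hlt (p (Fin.last n))
    omega
  · intro i
    refine Fin.lastCases ?_ (fun i => ?_) i
    · rw [Fin.snoc_last, Nat.cast_sub (by have := hlt (p (Fin.last n)); omega)]
      simp [hcast]
    · rw [Fin.snoc_castSucc, Nat.cast_sub (hle i)]
      simp [hcast]

/-- Cut the cyclic order at the selected gap `c i₀` and start from the point after it. -/
theorem StartDiff.points_surjective {sel : Multiset ℕ → ℕ} {k r : ℕ} [NeZero k]
    (hsel : ∀ P : Multiset ℕ, P.card = r + 2 → P.sum = k → P.count (sel P) = 1)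
    (T : Multiset (ZMod k)) (hT : T.card = r + 2) :
    ∃ e : StartDiff sel k r, e.points = T := by
  obtain ⟨y, c, rfl, hc, hy⟩ := exists_cyclic_order T hT
  have hcount := hsel (Finset.univ.val.map c) (by simp) hc
  obtain ⟨i₀, -, hi₀⟩ := Multiset.mem_map.1 (Multiset.count_pos.1 (hcount ▸ Nat.one_pos))
  let D : Fin (r + 1) → ℕ := fun j => c (i₀ + 1 + j.castSucc)
  have hlast : i₀ + 1 + Fin.last (r + 1) = i₀ := by
    rw [add_assoc i₀, add_comm (1 : Fin (r + 1 + 1)), Fin.last_add_one, add_zero]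
  have hmap : Finset.univ.val.map c = c i₀ ::ₘ Finset.univ.val.map D := by
    conv_lhs => rw [← Multiset.map_univ_val_equiv (Equiv.addLeft (i₀ + 1)), Multiset.map_map]
    rw [Fin.univ_castSuccEmb]
    simp only [Finset.cons_val, Finset.map_val, Multiset.map_cons, Multiset.map_map]
    simp only [Function.comp_apply, Equiv.coe_addLeft, hlast]
    rfl
  have hsum : c i₀ + ∑ i, D i = k := by
    have := congrArg Multiset.sum hmap
    rw [Multiset.sum_cons] at this
    exact this.symm.trans hc
  have hv : k - ∑ i, D i = c i₀ := by omega
  have hD : D ∈ selectedTuples sel k r := by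
    rw [mem_selectedTuples, cyclicParts, hv, ← hmap, hi₀]
    exact ⟨by omega, rfl⟩
  refine ⟨(y (i₀ + 1), ⟨D, hD⟩), ?_⟩
  have hpt : ∀ j ≤ r + 1, ((StartDiff.rot sel k r ^ j) (y (i₀ + 1), ⟨D, hD⟩)).1 =
      y (i₀ + 1 + (j : Fin (r + 2))) := by
    intro j hj
    rw [StartDiff.rot_pow_fst]
    induction j with
    | zero => simp
    | succ j ih =>
      rw [Finset.sum_range_succ, ← add_assoc, ih (by omega)]
      have hcs : Fin.castSucc (j : Fin (r + 1)) = (j : Fin (r + 2)) := by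
        ext
        rw [Fin.val_castSucc, Fin.val_natCast, Fin.val_natCast, Nat.mod_eq_of_lt (by omega),
          Nat.mod_eq_of_lt (by omega)]
      simp only [D, hcs]
      rw [← hy]
      push_cast
      rw [add_assoc (i₀ + 1)]
  unfold StartDiff.points
  rw [Multiset.map_congr rfl fun j hj => hpt j (by have := Multiset.mem_range.1 hj; omega),
    ← Multiset.map_univ_val_equiv (Equiv.addLeft (i₀ + 1)), Multiset.map_map, Fin.univ_val_map,
    ← Multiset.coe_range, Multiset.map_coe]
  congr 1
  apply List.ext_getElem
  · simp
  · intro i h1 h2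
    have hi : i < r + 2 := by simpa using h1
    rw [List.getElem_ofFn, List.getElem_map, List.getElem_range, Function.comp_apply]
    have hcast : (i : Fin (r + 2)) = ⟨i, hi⟩ := by
      ext
      rw [Fin.val_natCast, Nat.mod_eq_of_lt hi]
    rw [hcast]
    rfl

theorem map_insertNth_univ {n : ℕ} (i : Fin (n + 1)) (v : ℕ) (D : Fin n → ℕ) :
    Finset.univ.val.map (Fin.insertNth (α := fun _ => ℕ) i v D) =
      v ::ₘ Finset.univ.val.map D := by
  rw [Fin.univ_succAbove _ i]
  simp only [Finset.cons_val, Finset.map_val, Multiset.map_cons, Multiset.map_map,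
    Fin.insertNth_apply_same]
  congr 1
  exact Multiset.map_congr rfl fun j _ => by simp

/-- Inserting the selected part at any of the `r + 2` positions gives distinct compositions of `k`:
the rule recovers the value of the part, and multiplicity one recovers its position. -/
theorem card_selectedTuples_mul_le {sel : Multiset ℕ → ℕ} {k r : ℕ}
    (hsel : ∀ P : Multiset ℕ, P.card = r + 2 → P.sum = k → P.count (sel P) = 1) :
    (selectedTuples sel k r).card * (r + 2) ≤ (k + r + 1).choose (r + 1) := by
  let F : {D // D ∈ selectedTuples sel k r} × Fin (r + 2) → {c : Fin (r + 2) → ℕ // ∑ i, c i = k} :=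
    fun p => ⟨Fin.insertNth (α := fun _ => ℕ) p.2 (k - ∑ i, p.1.1 i) p.1.1, by
      have h := congrArg Multiset.sum (map_insertNth_univ p.2 (k - ∑ i, p.1.1 i) p.1.1)
      have h2 := (mem_selectedTuples.1 p.1.2).1
      rw [Multiset.sum_cons] at h
      exact h.trans (Nat.sub_add_cancel h2)⟩
  have hF : Function.Injective F := by
    rintro ⟨⟨D, hD⟩, i⟩ ⟨⟨D', hD'⟩, i'⟩ h
    have h : Fin.insertNth (α := fun _ => ℕ) i (k - ∑ i, D i) D =
      Fin.insertNth (α := fun _ => ℕ) i' (k - ∑ i, D' i) D' := congrArg Subtype.val h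
    have hP : cyclicParts k D = cyclicParts k D' := by
      rw [cyclicParts, cyclicParts, ← map_insertNth_univ i, ← map_insertNth_univ i', h]
    have hs := mem_selectedTuples.1 hD
    have hs' := mem_selectedTuples.1 hD'
    have hv : k - ∑ i, D i = k - ∑ i, D' i := by rw [← hs.2, ← hs'.2, hP]
    have hc := hsel (cyclicParts k D) (by simp [cyclicParts])
      (by rw [cyclicParts, Multiset.sum_cons]; exact Nat.sub_add_cancel hs.1)
    rw [hs.2, cyclicParts, ← map_insertNth_univ i, Multiset.count_map, Multiset.card_eq_one] at hc
    obtain ⟨a, ha⟩ := hc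
    have hi : i ∈ ({a} : Multiset (Fin (r + 2))) := by
      rw [← ha, Multiset.mem_filter]
      exact ⟨Finset.mem_univ i, by simp⟩
    have hi' : i' ∈ ({a} : Multiset (Fin (r + 2))) := by
      rw [← ha, Multiset.mem_filter]
      exact ⟨Finset.mem_univ i', by rw [h, hv]; simp⟩
    rw [Multiset.mem_singleton] at hi hi'
    subst hi hi'
    rw [Fin.insertNth_injective2.eq_iff] at h
    simp [h.2]
  have h := Fintype.card_le_of_injective _
    (((Sym.equivNatSumOfFintype (Fin (r + 2)) k).symm.injective).comp hF)
  rw [Fintype.card_prod, Fintype.card_coe, Fintype.card_fin, Sym.card_sym_eq_choose,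
    Fintype.card_fin] at h
  refine h.trans (le_of_eq ?_)
  rw [show r + 2 + k - 1 = k + (r + 1) by omega, Nat.choose_symm_add, ← add_assoc]

/-- The upper bound on the number of edges equals the number of multisets, so the surjection
`points` must be a bijection. -/
theorem StartDiff.card_eq_and_points_injective {sel : Multiset ℕ → ℕ} {k r : ℕ} [NeZero k]
    (hsel : ∀ P : Multiset ℕ, P.card = r + 2 → P.sum = k → P.count (sel P) = 1) :
    Fintype.card (StartDiff sel k r) = (k + r + 1).choose (r + 2) ∧
      Function.Injective (StartDiff.points (sel := sel) (k := k) (r := r)) := by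
  let W : StartDiff sel k r → Sym (ZMod k) (r + 2) := fun e => ⟨e.points, by
    simp [StartDiff.points]⟩
  have hW : Function.Surjective W := fun T => by
    obtain ⟨e, he⟩ := StartDiff.points_surjective hsel T.1 T.2
    exact ⟨e, Subtype.ext he⟩
  have hsym : Fintype.card (Sym (ZMod k) (r + 2)) = (k + r + 1).choose (r + 2) := by
    rw [Sym.card_sym_eq_choose, ZMod.card]
    rfl
  have hge := Fintype.card_le_of_surjective W hW
  have hle : Fintype.card (StartDiff sel k r) ≤ (k + r + 1).choose (r + 2) := by
    rw [Fintype.card_prod, ZMod.card, Fintype.card_coe]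
    refine Nat.le_of_mul_le_mul_right ?_ (Nat.succ_pos (r + 1))
    have h1 := Nat.choose_succ_right_eq (k + r + 1) (r + 1)
    rw [show k + r + 1 - (r + 1) = k by omega] at h1
    rw [Nat.succ_eq_add_one, h1, mul_assoc, mul_comm ((k + r + 1).choose (r + 1))]
    exact Nat.mul_le_mul_left k (card_selectedTuples_mul_le hsel)
  have hcard : Fintype.card (StartDiff sel k r) = (k + r + 1).choose (r + 2) :=
    le_antisymm hle (hsym ▸ hge)
  refine ⟨hcard, fun e f hef => ?_⟩
  exact ((Fintype.bijective_iff_surjective_and_card W).2 ⟨hW, hcard.trans hsym.symm⟩).1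
    (Subtype.ext hef)

/-! ### Connectedness and the general criterion -/

/-- Connectedness of the graph whose edges are the elements of `StartDiff sel k r`. -/
abbrev StartDiff.Conn {sel : Multiset ℕ → ℕ} {k r : ℕ} :
    StartDiff sel k r → StartDiff sel k r → Prop :=
  Relation.EqvGen fun e f => e.src = f.src ∨ f = StartDiff.rot sel k r e

theorem StartDiff.conn_rot_pow {sel : Multiset ℕ → ℕ} {k r : ℕ} (e : StartDiff sel k r) (j : ℕ) :
    e.Conn ((StartDiff.rot sel k r ^ j) e) := by
  induction j with
  | zero => exact .refl _
  | succ j ih =>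
    rw [pow_succ', Equiv.Perm.mul_apply]
    exact ih.trans _ _ _ (.rel _ _ (Or.inr rfl))

/-- Up to the starting point, any one difference may be changed. -/
theorem StartDiff.exists_conn_update {sel : Multiset ℕ → ℕ} {k r : ℕ} (e : StartDiff sel k r)
    (i : Fin (r + 1)) (c : ℕ) (h : Function.update e.2.1 i c ∈ selectedTuples sel k r) :
    ∃ x, e.Conn (x, ⟨Function.update e.2.1 i c, h⟩) := by
  -- Rotating by `i + 1` puts the `i`-th difference in the last slot, which `src` does not see;
  -- after the change the rotation is undone.
  let e₁ := (StartDiff.rot sel k r ^ (i + 1 : Fin (r + 1)).val) e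
  let f₁ : StartDiff sel k r := (e₁.1, ⟨_, shift_mem_selectedTuples h (i + 1)⟩)
  have h₁ : e₁.Conn f₁ := by
    refine .rel _ _ (Or.inl (Prod.ext rfl (funext fun t => ?_)))
    simp only [StartDiff.src, e₁, f₁, StartDiff.rot_pow_snd, Fin.cast_val_eq_self]
    rw [Function.update_of_ne]
    intro ht
    have ht' : t.castSucc = Fin.last r := by
      have h0 : t.castSucc + 1 = Fin.last r + 1 := by
        rw [Fin.last_add_one]
        linear_combination ht
      exact add_right_cancel h0
    exact (Fin.castSucc_lt_last t).ne ht'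
  have h₂ := StartDiff.conn_rot_pow f₁ (-(i + 1) : Fin (r + 1)).val
  refine ⟨((StartDiff.rot sel k r ^ (-(i + 1) : Fin (r + 1)).val) f₁).1,
    (StartDiff.conn_rot_pow e _).trans _ _ _ (h₁.trans _ _ _ ?_)⟩
  convert h₂ using 1
  refine Prod.ext rfl (Subtype.ext ?_)
  rw [StartDiff.rot_pow_snd]
  funext t
  simp only [f₁, Fin.cast_val_eq_self]
  congr 1
  ring

theorem exists_map_univ_eq_cons {n : ℕ} (D : Fin n → ℕ) (i : Fin n) :
    ∃ R : Multiset ℕ, Finset.univ.val.map D = D i ::ₘ R ∧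
      ∀ c, Finset.univ.val.map (Function.update D i c) = c ::ₘ R := by
  have hu : (Finset.univ : Finset (Fin n)).val = i ::ₘ (Finset.univ.erase i).val := by
    rw [← Finset.insert_val_of_notMem (Finset.notMem_erase i _),
      Finset.insert_erase (Finset.mem_univ i)]
  refine ⟨(Finset.univ.erase i).val.map D, by rw [hu, Multiset.map_cons], fun c => ?_⟩
  rw [hu, Multiset.map_cons, Function.update_self]
  congr 1
  refine Multiset.map_congr rfl fun j hj => Function.update_of_ne ?_ _ _
  exact Finset.ne_of_mem_erase (Finset.mem_def.2 hj)

/-- The value of `M_m(k)` from a rule which selects a part of multiplicity one in every multiset of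
`m` natural numbers with sum `k`. -/
theorem maxDistinguishableLength_eq_of_rule {k r : ℕ} (hk : 3 ≤ k) (sel : Multiset ℕ → ℕ)
    (hsel : ∀ P : Multiset ℕ, P.card = r + 2 → P.sum = k → P.count (sel P) = 1)
    (hmax : ∀ (v : ℕ) (P : Multiset ℕ), P.card = r + 1 → (0 ∈ P ∨ P.card = 1) →
      (∀ w ∈ P, w < v) → sel (v ::ₘ P) = v)
    (hzero : ∀ P : Multiset ℕ, P.card = r + 1 → P.sum = k → sel (0 ::ₘ P) = 0 →
      ∃ a c R, P = a ::ₘ R ∧ c < a ∧ sel ((a - c) ::ₘ c ::ₘ R) = a - c) :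
    maxDistinguishableLength (r + 2) k = (k + (r + 2) - 1).choose (r + 2) + (r + 2) - 1 := by
  have : NeZero k := ⟨by omega⟩
  obtain ⟨hcard, hinj⟩ := StartDiff.card_eq_and_points_injective hsel
  have h0 : (0 : Fin (r + 1) → ℕ) ∈ selectedTuples sel k r := by
    rw [mem_selectedTuples, cyclicParts]
    refine ⟨by simp, hmax _ _ (by simp) (Or.inl ?_) ?_⟩
    · simp
    · intro w hw
      obtain ⟨i, -, rfl⟩ := Multiset.mem_map.1 hw
      simp
      omega
  -- Resetting a largest difference to 0 adds it to the positive appended part, which then strictly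
  -- exceeds all others, so `hmax` applies.
  have hpos : ∀ (n : ℕ) (e : StartDiff sel k r), ∑ i, e.2.1 i = n → n < k →
      ∃ x, e.Conn (x, ⟨0, h0⟩) := by
    intro n
    induction n using Nat.strong_induction_on with
    | _ n ih =>
      rintro ⟨x, D, hD⟩ hn hnk
      obtain ⟨i, hi⟩ := Finite.exists_max D
      rcases Nat.eq_zero_or_pos (D i) with h | h
      · refine ⟨x, ?_⟩
        have : D = 0 := funext fun j => Nat.le_zero.1 (h ▸ hi j)
        subst this
        exact .refl _
      · obtain ⟨R, hR, hR'⟩ := exists_map_univ_eq_cons D i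
        have hs : ∑ i, D i = D i + R.sum := by
          rw [← Multiset.sum_cons, ← hR]; rfl
        have hs' : ∑ j, Function.update D i 0 j = R.sum := by
          have := congrArg Multiset.sum (hR' 0)
          rw [Multiset.sum_cons, zero_add] at this
          exact this
        dsimp only at hn
        have hD' : Function.update D i 0 ∈ selectedTuples sel k r := by
          rw [mem_selectedTuples, cyclicParts, hs']
          refine ⟨by omega, hmax _ _ (by simp) (Or.inl ?_) ?_⟩
          · rw [hR' 0]; simp
          · intro w hw
            have hw' : w ≤ D i := by
              obtain ⟨j, -, rfl⟩ := Multiset.mem_map.1 hw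
              rcases eq_or_ne j i with rfl | hj
              · simp
              · rw [Function.update_of_ne hj]; exact hi j
            omega
        obtain ⟨x₁, h₁⟩ := StartDiff.exists_conn_update (⟨x, D, hD⟩ : StartDiff sel k r) i 0 hD'
        obtain ⟨x₂, h₂⟩ := ih R.sum (by omega) (x₁, ⟨_, hD'⟩) hs' (by omega)
        exact ⟨x₂, h₁.trans _ _ _ h₂⟩
  have hall : ∀ e : StartDiff sel k r, ∃ x, e.Conn (x, ⟨0, h0⟩) := by
    rintro ⟨x, D, hD⟩
    obtain ⟨hle, hD'⟩ := mem_selectedTuples.1 hD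
    -- If the appended part is 0, no difference can be absorbed this way; `hzero` first splits one
    -- to make the appended part positive.
    rcases hle.lt_or_eq with hlt | heq
    · exact hpos _ _ rfl hlt
    · rw [cyclicParts, heq, Nat.sub_self] at hD'
      obtain ⟨a, c, R, hP, hca, hs⟩ := hzero _ (by simp) heq hD'
      obtain ⟨i, -, hi⟩ := Multiset.mem_map.1 (hP ▸ Multiset.mem_cons_self a R)
      obtain ⟨R', hR, hR'⟩ := exists_map_univ_eq_cons D i
      rw [hi, hP, Multiset.cons_inj_right] at hR
      subst hR
      have hsum : ∑ i, D i = a + R.sum := by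
        rw [← Multiset.sum_cons, ← hP]; rfl
      have hsum' : ∑ j, Function.update D i c j = c + R.sum := by
        rw [← Multiset.sum_cons, ← hR' c]; rfl
      have hmem : Function.update D i c ∈ selectedTuples sel k r := by
        rw [mem_selectedTuples, cyclicParts, hsum', hR' c,
          show k - (c + R.sum) = a - c by omega]
        exact ⟨by omega, hs⟩
      obtain ⟨x₁, h₁⟩ := StartDiff.exists_conn_update (⟨x, D, hD⟩ : StartDiff sel k r) i c hmem
      obtain ⟨x₂, h₂⟩ := hpos _ (x₁, ⟨_, hmem⟩) hsum' (by omega)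
      exact ⟨x₂, h₁.trans _ _ _ h₂⟩
  -- A single difference 1 leaves the appended part $k-1>1$, hence `3 ≤ k`. One full rotation then
  -- shifts the start by 1.
  have hone : Pi.single (Fin.last r) 1 ∈ selectedTuples sel k r := by
    rw [mem_selectedTuples, cyclicParts, Finset.sum_pi_single']
    simp only [Finset.mem_univ, if_true]
    refine ⟨by omega, hmax _ _ (by simp) ?_ ?_⟩
    · rcases Nat.eq_zero_or_pos r with rfl | hr
      · simp
      · refine Or.inl (Multiset.mem_map.2 ⟨0, Finset.mem_def.1 (Finset.mem_univ _), ?_⟩)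
        rw [Pi.single_eq_of_ne]
        intro h
        have := congrArg Fin.val h
        simp at this
        omega
    · intro w hw
      obtain ⟨i, -, rfl⟩ := Multiset.mem_map.1 hw
      rw [Pi.single_apply]
      split_ifs <;> omega
  have hstep : ∀ x : ZMod k, StartDiff.Conn (sel := sel) (r := r) (x, ⟨0, h0⟩) (x + 1, ⟨0, h0⟩) := by
    intro x
    have hsrc : ∀ x : ZMod k, StartDiff.Conn (sel := sel) (r := r) (x, ⟨0, h0⟩)
        (x, ⟨Pi.single (Fin.last r) 1, hone⟩) := fun x => by
      refine .rel _ _ (Or.inl (Prod.ext rfl (funext fun t => ?_)))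
      simp only [StartDiff.src]
      rw [Pi.single_eq_of_ne (Fin.castSucc_lt_last t).ne]
      rfl
    refine (hsrc x).trans _ _ _ (Relation.EqvGen.trans _ _ _ ?_ ((hsrc (x + 1)).symm))
    have := StartDiff.conn_rot_pow (sel := sel) (x, ⟨Pi.single (Fin.last r) 1, hone⟩) (r + 1)
    rw [StartDiff.rot_pow_card] at this
    simpa [Finset.sum_pi_single'] using this
  have hbase : ∀ x : ZMod k, StartDiff.Conn (sel := sel) (r := r) (0, ⟨0, h0⟩) (x, ⟨0, h0⟩) := by
    intro x
    rw [← ZMod.natCast_zmod_val x]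
    induction x.val with
    | zero => rw [Nat.cast_zero]; exact .refl _
    | succ n ih => rw [Nat.cast_succ]; exact ih.trans _ _ _ (hstep _)
  have hroot : ∀ e : StartDiff sel k r, StartDiff.Conn (0, ⟨0, h0⟩) e := fun e => by
    obtain ⟨x, hx⟩ := hall e
    exact (hbase x).trans _ _ _ (hx.symm)
  obtain ⟨τ, hτ, hcyc⟩ := exists_perm_sameCycle_of_eqvGen StartDiff.src (StartDiff.rot sel k r)
    fun e f => ((hroot e).symm).trans _ _ _ (hroot f)
  have : Nonempty (StartDiff sel k r) := ⟨(0, ⟨0, h0⟩)⟩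
  obtain ⟨s, hs, hlen⟩ := exists_isDistinguishable_of_sameCycle (r + 2) (by omega) Prod.fst τ hcyc
    (by
      intro e f hef
      refine hinj ?_
      simp only at hef
      rw [StartDiff.points, StartDiff.points]
      convert hef using 1 <;>
      · refine Multiset.map_congr rfl fun j hj => ?_
        exact (StartDiff.pow_fst_eq_rot_pow_fst hτ
          (by have := Multiset.mem_range.1 hj; omega) _).symm)
  refine maxDistinguishableLength_eq_of_isDistinguishable (by omega) (ZMod.card k) hs ?_
  rw [hlen, hcard]
  rfl

end CyclicDifferences

/-! ### Simple parts and their existence -/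

/-- The largest element of multiplicity one. -/
def largestSimple (P : Multiset ℕ) : ℕ := {v ∈ P.toFinset | P.count v = 1}.sup id

theorem le_largestSimple {P : Multiset ℕ} {v : ℕ} (h : P.count v = 1) : v ≤ largestSimple P :=
  Finset.le_sup (f := id) (Finset.mem_filter.2
    ⟨Multiset.mem_toFinset.2 (Multiset.count_pos.1 (by omega)), h⟩)

theorem count_largestSimple {P : Multiset ℕ} (h : ∃ v, P.count v = 1) :
    P.count (largestSimple P) = 1 := by
  obtain ⟨v, hv⟩ := h
  obtain ⟨w, hw, hw'⟩ := Finset.exists_mem_eq_sup {v ∈ P.toFinset | P.count v = 1}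
    ⟨v, Finset.mem_filter.2 ⟨Multiset.mem_toFinset.2 (Multiset.count_pos.1 (by omega)), hv⟩⟩ id
  rw [largestSimple, hw']
  exact (Finset.mem_filter.1 hw).2

theorem largestSimple_eq {P : Multiset ℕ} {v : ℕ} (h : P.count v = 1)
    (hle : ∀ w, P.count w = 1 → w ≤ v) : largestSimple P = v :=
  le_antisymm (hle _ (count_largestSimple ⟨v, h⟩)) (le_largestSimple h)

theorem exists_replicate_add_of_count_ne_one {P : Multiset ℕ} (hP : ∀ v, P.count v ≠ 1)
    (h0 : P.card ≠ 0) :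
    ∃ (c a : ℕ) (Q : Multiset ℕ), 2 ≤ c ∧ P = Multiset.replicate c a + Q ∧
      c + Q.card = P.card ∧ ∀ v, Q.count v ≠ 1 := by
  obtain ⟨a, ha⟩ := Multiset.card_pos_iff_exists_mem.1 (Nat.pos_of_ne_zero h0)
  have h1 := Multiset.count_pos.2 ha
  have h2 := hP a
  have h3 : P = Multiset.replicate (P.count a) a + P.filter (¬ a = ·) := by
    rw [← Multiset.filter_eq, Multiset.filter_add_not]
  refine ⟨P.count a, a, P.filter (¬ a = ·), by omega, h3, ?_, fun v => ?_⟩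
  · conv_rhs => rw [h3]
    simp
  · rw [Multiset.count_filter]
    split_ifs
    · exact Nat.zero_ne_one
    · exact hP v

theorem eq_replicate_of_count_ne_one {P : Multiset ℕ} (hP : ∀ v, P.count v ≠ 1)
    (h1 : P.card ≠ 0) (h2 : P.card < 4) : 2 ≤ P.card ∧ ∃ a, P = Multiset.replicate P.card a := by
  obtain ⟨c, a, Q, hc, rfl, hcard, hQ⟩ := exists_replicate_add_of_count_ne_one hP h1
  by_cases hQ0 : Q.card = 0
  · rw [Multiset.card_eq_zero] at hQ0
    subst hQ0
    exact ⟨by simpa using hc, a, by simp⟩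
  · obtain ⟨c', a', Q', hc', rfl, hcard', hQ'⟩ := exists_replicate_add_of_count_ne_one hQ hQ0
    omega

theorem eq_replicate_or_of_card_eq_five {P : Multiset ℕ} (hP : ∀ v, P.count v ≠ 1)
    (h5 : P.card = 5) : (∃ a, P = Multiset.replicate 5 a) ∨
      ∃ a b, P = Multiset.replicate 2 a + Multiset.replicate 3 b := by
  obtain ⟨c, a, Q, hc, rfl, hcard, hQ⟩ := exists_replicate_add_of_count_ne_one hP (by omega)
  rw [h5] at hcard
  by_cases hQ0 : Q.card = 0
  · obtain rfl : c = 5 := by omega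
    rw [Multiset.card_eq_zero] at hQ0
    exact Or.inl ⟨a, by simp [hQ0]⟩
  · obtain ⟨h2, b, hb⟩ := eq_replicate_of_count_ne_one hQ hQ0 (by omega)
    right
    rcases (by omega : c = 2 ∧ Q.card = 3 ∨ c = 3 ∧ Q.card = 2) with ⟨rfl, h⟩ | ⟨rfl, h⟩
    · exact ⟨a, b, by rw [hb, h]⟩
    · exact ⟨b, a, by rw [hb, h, add_comm]⟩

theorem two_dvd_sum_of_card_eq_four {P : Multiset ℕ} (hP : ∀ v, P.count v ≠ 1)
    (h4 : P.card = 4) : 2 ∣ P.sum := by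
  obtain ⟨c, a, Q, hc, rfl, hcard, hQ⟩ := exists_replicate_add_of_count_ne_one hP (by omega)
  rw [h4] at hcard
  rw [Multiset.sum_add, Multiset.sum_replicate, smul_eq_mul]
  by_cases hQ0 : Q.card = 0
  · obtain rfl : c = 4 := by omega
    rw [Multiset.card_eq_zero.1 hQ0, Multiset.sum_zero]
    omega
  · obtain ⟨h2, b, hb⟩ := eq_replicate_of_count_ne_one hQ hQ0 (by omega)
    obtain rfl : c = 2 := by omega
    rw [hb, Multiset.sum_replicate, smul_eq_mul, show Q.card = 2 by omega]
    omega

/-- The multiplicities can only be 6, 4+2, 3+3 or 2+2+2, each with a common factor 2 or 3. -/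
theorem two_or_three_dvd_sum_of_card_eq_six {P : Multiset ℕ} (hP : ∀ v, P.count v ≠ 1)
    (h6 : P.card = 6) : 2 ∣ P.sum ∨ 3 ∣ P.sum := by
  obtain ⟨c, a, Q, hc, rfl, hcard, hQ⟩ := exists_replicate_add_of_count_ne_one hP (by omega)
  rw [h6] at hcard
  rw [Multiset.sum_add, Multiset.sum_replicate, smul_eq_mul]
  by_cases hQ0 : Q.card = 0
  · obtain rfl : c = 6 := by omega
    rw [Multiset.card_eq_zero.1 hQ0, Multiset.sum_zero]
    omega
  · by_cases hQ4 : Q.card = 4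
    · have := two_dvd_sum_of_card_eq_four hQ hQ4
      obtain rfl : c = 2 := by omega
      omega
    · obtain ⟨h2, b, hb⟩ := eq_replicate_of_count_ne_one hQ hQ0 (by omega)
      rcases (by omega : c = 4 ∧ Q.card = 2 ∨ c = 3 ∧ Q.card = 3) with ⟨rfl, h⟩ | ⟨rfl, h⟩
      · rw [hb, Multiset.sum_replicate, smul_eq_mul, h]
        omega
      · rw [hb, Multiset.sum_replicate, smul_eq_mul, h]
        omega

/-! ### The selection rule and the individual values of `m` -/

/-- Select the largest element of multiplicity one, with one exceptional multiset. -/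
def largestSimpleExcept (P₀ : Multiset ℕ) (v₀ : ℕ) (P : Multiset ℕ) : ℕ :=
  if P = P₀ then v₀ else largestSimple P

theorem largestSimpleExcept_eq {P₀ P : Multiset ℕ} {v₀ v : ℕ} (hne : P ≠ P₀)
    (h : P.count v = 1) (hle : ∀ w, P.count w = 1 → w ≤ v) :
    largestSimpleExcept P₀ v₀ P = v := by
  rw [largestSimpleExcept, if_neg hne, largestSimple_eq h hle]

/-- Zero is the largest simple part only if no positive part is simple, so the splitting condition
concerns only multisets of positive parts without simple ones. -/
theorem maxDistinguishableLength_eq_of_exists_simple {k r : ℕ} (hk : 3 ≤ k)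
    (P₀ : Multiset ℕ) (v₀ : ℕ) (h0 : 0 ∉ P₀) (h2 : P₀.card ≠ 2)
    (hv₀ : P₀.card = r + 2 → P₀.sum = k → P₀.count v₀ = 1)
    (hsimple : ∀ P : Multiset ℕ, P.card = r + 2 → P.sum = k → ∃ v, P.count v = 1)
    (hzero : ∀ P : Multiset ℕ, P.card = r + 1 → P.sum = k → 0 ∉ P → (∀ v, P.count v ≠ 1) →
      ∃ a c R, P = a ::ₘ R ∧ c < a ∧
        largestSimpleExcept P₀ v₀ ((a - c) ::ₘ c ::ₘ R) = a - c) :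
    maxDistinguishableLength (r + 2) k = (k + (r + 2) - 1).choose (r + 2) + (r + 2) - 1 := by
  have hsel : ∀ P : Multiset ℕ, P.card = r + 2 → P.sum = k →
      P.count (largestSimpleExcept P₀ v₀ P) = 1 := by
    intro P hP hs
    rw [largestSimpleExcept]
    split_ifs with h
    · subst h
      exact hv₀ hP hs
    · exact count_largestSimple (hsimple P hP hs)
  refine maxDistinguishableLength_eq_of_rule hk (largestSimpleExcept P₀ v₀) hsel ?_ ?_
  · intro v P hP hor hlt
    have hv : v ∉ P := fun h => (hlt v h).false
    refine largestSimpleExcept_eq ?_ ?_ ?_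
    · rintro rfl
      rcases hor with h | h
      · exact h0 (Multiset.mem_cons_of_mem h)
      · exact h2 (by rw [Multiset.card_cons, h])
    · rw [Multiset.count_cons_self, Multiset.count_eq_zero_of_notMem hv]
    · intro w hw
      rcases Multiset.mem_cons.1 (Multiset.count_pos.1 (hw ▸ Nat.one_pos)) with rfl | h
      · exact le_rfl
      · exact (hlt w h).le
  · intro P hP hs hsel0
    have hc := hsel (0 ::ₘ P) (by rw [Multiset.card_cons, hP]) (by rw [Multiset.sum_cons, zero_add, hs])
    rw [hsel0, Multiset.count_cons_self] at hc
    have h0P : P.count 0 = 0 := by omega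
    have hne : (0 ::ₘ P) ≠ P₀ := by
      rintro rfl
      exact h0 (Multiset.mem_cons_self 0 P)
    rw [largestSimpleExcept, if_neg hne] at hsel0
    refine hzero P hP hs (Multiset.count_eq_zero.1 h0P) fun v hv => ?_
    rcases Nat.eq_zero_or_pos v with rfl | hpos
    · omega
    · have := le_largestSimple (P := 0 ::ₘ P) (v := v)
        (by rw [Multiset.count_cons_of_ne hpos.ne', hv])
      omega

theorem maxDistinguishableLength_two {k : ℕ} (hk : 3 ≤ k) (hodd : Odd k) :
    maxDistinguishableLength 2 k = (k + 2 - 1).choose 2 + 2 - 1 := by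
  rw [Nat.odd_iff] at hodd
  refine maxDistinguishableLength_eq_of_exists_simple (r := 0) hk 0 0 (by simp) (by simp)
    (by simp) ?_ ?_
  · intro P hP hs
    by_contra! hns
    obtain ⟨-, a, ha⟩ := eq_replicate_of_count_ne_one hns (by omega) (by omega)
    rw [ha, hP, Multiset.sum_replicate, smul_eq_mul] at hs
    omega
  · intro P hP hs h0 hns
    have := eq_replicate_of_count_ne_one hns (by omega) (by omega)
    omega

/-- The only multiset to split is $\{a,a\}$ with $k=2a$. In $\{a-1,1,a\}$ the largest simple part is
$a$, so the exception selects $a-1$ instead. For $k=4$ this fails, as $a-1=1$ is repeated. -/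
theorem maxDistinguishableLength_three {k : ℕ} (hk : 5 ≤ k) (hcop : ¬ 3 ∣ k) :
    maxDistinguishableLength 3 k = (k + 3 - 1).choose 3 + 3 - 1 := by
  refine maxDistinguishableLength_eq_of_exists_simple (r := 1) (by omega)
    ((k / 2 - 1) ::ₘ 1 ::ₘ {k / 2}) (k / 2 - 1) ?_ (by simp) ?_ ?_ ?_
  · simp only [Multiset.mem_cons, Multiset.mem_singleton]
    omega
  · intro _ hs
    simp only [Multiset.sum_cons, Multiset.sum_singleton] at hs
    simp only [Multiset.count_cons, Multiset.count_singleton]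
    split_ifs <;> omega
  · intro P hP hs
    by_contra! hns
    obtain ⟨-, a, ha⟩ := eq_replicate_of_count_ne_one hns (by omega) (by omega)
    rw [ha, hP, Multiset.sum_replicate, smul_eq_mul] at hs
    omega
  · intro P hP hs h0 hns
    obtain ⟨-, a, ha⟩ := eq_replicate_of_count_ne_one hns (by omega) (by omega)
    rw [hP] at ha
    rw [ha, Multiset.sum_replicate, smul_eq_mul] at hs
    obtain rfl : a = k / 2 := by omega
    exact ⟨k / 2, 1, {k / 2}, ha, by omega, if_pos rfl⟩

theorem maxDistinguishableLength_four {k : ℕ} (hk : 5 ≤ k) (hcop : ¬ 2 ∣ k) :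
    maxDistinguishableLength 4 k = (k + 4 - 1).choose 4 + 4 - 1 := by
  refine maxDistinguishableLength_eq_of_exists_simple (r := 2) (by omega) 0 0 (by simp) (by simp)
    (by simp) ?_ ?_
  · intro P hP hs
    by_contra! hns
    exact hcop (hs ▸ two_dvd_sum_of_card_eq_four hns hP)
  · intro P hP hs h0 hns
    obtain ⟨-, a, ha⟩ := eq_replicate_of_count_ne_one hns (by omega) (by omega)
    rw [hP] at ha
    rw [ha, Multiset.sum_replicate, smul_eq_mul] at hs
    refine ⟨a, 1, Multiset.replicate 2 a, ha, by omega,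
      largestSimpleExcept_eq (Multiset.cons_ne_zero) ?_ fun w => ?_⟩
    · simp only [Multiset.count_cons, Multiset.count_replicate]
      split_ifs <;> omega
    · simp only [Multiset.count_cons, Multiset.count_replicate]
      split_ifs <;> omega

theorem maxDistinguishableLength_six {k : ℕ} (hk : 11 ≤ k) (h2 : ¬ 2 ∣ k) (h3 : ¬ 3 ∣ k) :
    maxDistinguishableLength 6 k = (k + 6 - 1).choose 6 + 6 - 1 := by
  -- For $\{s,s,1,1,1\}$ a 1 cannot be split into positive parts, so an `s` is split; the exception
  -- selects $s-1$ although `s` is also simple.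
  obtain ⟨s, hs⟩ : ∃ s, s = (k - 3) / 2 := ⟨_, rfl⟩
  have hcount : ((s - 1) ::ₘ 1 ::ₘ (Multiset.replicate 3 1 + {s})).count 1 = 4 := by
    simp only [Multiset.count_cons, Multiset.count_add, Multiset.count_replicate,
      Multiset.count_singleton]
    split_ifs <;> omega
  refine maxDistinguishableLength_eq_of_exists_simple (r := 4) (by omega)
    ((s - 1) ::ₘ 1 ::ₘ (Multiset.replicate 3 1 + {s})) (s - 1) ?_ (by simp) ?_ ?_ ?_
  · simp only [Multiset.mem_cons, Multiset.mem_add, Multiset.mem_replicate,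
      Multiset.mem_singleton]
    omega
  · intro _ _
    simp only [Multiset.count_cons, Multiset.count_add, Multiset.count_replicate,
      Multiset.count_singleton]
    split_ifs <;> omega
  · intro P hP hs
    by_contra! hns
    rcases two_or_three_dvd_sum_of_card_eq_six hns hP with h | h
    · exact h2 (hs ▸ h)
    · exact h3 (hs ▸ h)
  · intro P hP hsum h0 hns
    rcases eq_replicate_or_of_card_eq_five hns hP with ⟨a, rfl⟩ | ⟨a, b, rfl⟩
    · rw [Multiset.sum_replicate, smul_eq_mul] at hsum
      refine ⟨a, 1, Multiset.replicate 4 a, rfl, by omega,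
        largestSimpleExcept_eq ?_ ?_ fun w => ?_⟩
      · intro h
        rw [← h] at hcount
        simp only [Multiset.count_cons, Multiset.count_replicate] at hcount
        split_ifs at hcount <;> omega
      · simp only [Multiset.count_cons, Multiset.count_replicate]
        split_ifs <;> omega
      · simp only [Multiset.count_cons, Multiset.count_replicate]
        split_ifs <;> omega
    · rw [Multiset.sum_add, Multiset.sum_replicate, Multiset.sum_replicate, smul_eq_mul,
        smul_eq_mul] at hsum
      simp only [Multiset.mem_add, Multiset.mem_replicate, not_or] at h0
      by_cases hb : b = 1
      · subst hb
        obtain rfl : a = s := by omega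
        refine ⟨a, 1, Multiset.replicate 3 1 + {a}, ?_, by omega, ?_⟩
        · rw [add_comm, ← Multiset.add_cons]
          rfl
        · exact if_pos rfl
      -- Splitting `b` into $b-c$ and `c` works when $b-c$ is simple and `c` is either smaller or
      -- merged with the copies of `a`. The condition for $c=1$ avoids the exceptional multiset,
      -- which has four ones.
      have key : ∀ c, 0 < c → c < b → (c = 1 → a ≠ 1 ∨ b - c ≠ 1) → b - c ≠ c → a ≠ b - c →
          a = c ∨ c < b - c →
          largestSimpleExcept ((s - 1) ::ₘ 1 ::ₘ (Multiset.replicate 3 1 + {s})) (s - 1)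
            ((b - c) ::ₘ c ::ₘ (Multiset.replicate 2 a + Multiset.replicate 2 b)) = b - c := by
        intro c hc hcb hc1 hne hab hor
        refine largestSimpleExcept_eq ?_ ?_ fun w => ?_
        · intro h
          rw [← h] at hcount
          simp only [Multiset.count_cons, Multiset.count_add, Multiset.count_replicate] at hcount
          split_ifs at hcount <;> omega
        · simp only [Multiset.count_cons, Multiset.count_add, Multiset.count_replicate]
          split_ifs <;> omega
        · simp only [Multiset.count_cons, Multiset.count_add, Multiset.count_replicate]
          split_ifs <;> omega
      have hP : Multiset.replicate 2 a + Multiset.replicate 3 b =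
          b ::ₘ (Multiset.replicate 2 a + Multiset.replicate 2 b) := by
        rw [← Multiset.add_cons]
        rfl
      -- Here `b` is odd because `k` is. The choice $c=1$ fails when $a=b-1$; then $c=2$ works, and
      -- for $b=3$ it does so because $c=a$.
      by_cases hc : b = 3 ∧ a = 2 ∨ 3 < b ∧ (a = 1 ∨ a = b - 1)
      · exact ⟨b, 2, _, hP, by omega, key 2 (by omega) (by omega) (by omega) (by omega) (by omega)
          (by omega)⟩
      · exact ⟨b, 1, _, hP, by omega, key 1 (by omega) (by omega) (by omega) (by omega) (by omega)
          (by omega)⟩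

theorem isDistinguishable_of_forall_lt {α : Type*} {m : ℕ} {s : List α} (hm : m ≤ s.length)
    (h : ∀ t < s.length + 1 - m, ∀ t' < s.length + 1 - m,
      colorMultiset m s t = colorMultiset m s t' → t = t') : IsDistinguishable m s :=
  ⟨hm, fun t t' ht ht' => h t (by omega) t' (by omega)⟩

theorem maxDistinguishableLength_one {k : ℕ} (hk : 1 ≤ k) : maxDistinguishableLength 1 k = k := by
  refine (maxDistinguishableLength_eq_of_isDistinguishable (m := 1) hk (Fintype.card_fin k)
    (s := List.finRange k) ⟨by simpa using hk, fun t t' ht ht' h => ?_⟩ (by simp)).trans (by simp)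
  rw [List.length_finRange] at ht ht'
  rw [colorMultiset, colorMultiset, List.take_one_drop_eq_of_lt_length (by simpa using ht),
    List.take_one_drop_eq_of_lt_length (by simpa using ht')] at h
  simpa using h

theorem maxDistinguishableLength_two_one : maxDistinguishableLength 2 1 = 2 := by
  refine maxDistinguishableLength_eq_of_isDistinguishable (m := 2) le_rfl (Fintype.card_fin 1)
    (s := [0, 0]) ⟨by simp, fun t t' ht ht' _ => ?_⟩ (by simp)
  simp only [List.length_cons, List.length_nil] at ht ht'
  omega

/-- An explicit sequence whose 20 windows are all the 3-multisets on four colours. -/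
theorem maxDistinguishableLength_three_four : maxDistinguishableLength 3 4 = 22 := by
  refine maxDistinguishableLength_eq_of_isDistinguishable (m := 3) (by omega) (Fintype.card_fin 4)
    (s := [0, 0, 0, 1, 1, 1, 2, 0, 0, 3, 1, 3, 1, 2, 2, 0, 3, 3, 3, 2, 2, 2])
    (isDistinguishable_of_forall_lt (by simp) ?_) (by simp [Nat.choose])
  unfold colorMultiset
  decide

theorem mainTheorem11 :
    (∀ k : ℕ, 1 ≤ k → maxDistinguishableLength 1 k = k) ∧
    (∀ k : ℕ, Odd k → maxDistinguishableLength 2 k = (k + 1).choose 2 + 1) ∧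
    (∀ m k : ℕ, (m = 3 ∧ 4 ≤ k) ∨ (m = 4 ∧ 5 ≤ k) ∨ (m = 6 ∧ 11 ≤ k) → Nat.gcd m k = 1 →
      maxDistinguishableLength m k = (k + m - 1).choose m + m - 1) := by
  refine ⟨fun k hk => maxDistinguishableLength_one hk, fun k hk => ?_, ?_⟩
  · have hk' := Nat.odd_iff.1 hk
    rcases (by omega : k = 1 ∨ 3 ≤ k) with rfl | h
    · exact maxDistinguishableLength_two_one
    · exact maxDistinguishableLength_two h hk
  · intro m k hmk hgcd
    have hdvd : ∀ d, d ∣ m → d ∣ k → d = 1 := fun d h1 h2 =>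
      Nat.dvd_one.1 (hgcd ▸ Nat.dvd_gcd h1 h2)
    rcases hmk with ⟨rfl, hk⟩ | ⟨rfl, hk⟩ | ⟨rfl, hk⟩
    · rcases hk.eq_or_lt with rfl | hk
      · exact maxDistinguishableLength_three_four
      · exact maxDistinguishableLength_three hk fun h => absurd (hdvd 3 (by norm_num) h) (by norm_num)
    · exact maxDistinguishableLength_four hk fun h => absurd (hdvd 2 (by norm_num) h) (by norm_num)
    · exact maxDistinguishableLength_six hk
        (fun h => absurd (hdvd 2 (by norm_num) h) (by norm_num))
        (fun h => absurd (hdvd 3 (by norm_num) h) (by norm_num))
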